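/- Let $K$ be an algebraically closed field with a non-Archimedean valuation $\mathrm{val}\colon K\to\mathbb R\cup\{\infty\}$, let $0\le d<n$ be integers, and put $N=\binom nd$. Let $\mathrm{Gr}(m,n)$ be the Grassmannian of $m$-dimensional linear subspaces of $K^n$, with the Zariski topology coming from its Plücker embedding in $\mathbb P^{\binom nm-1}$. For $X\in \mathrm{Gr}(d+1,n)$ let $L(X)\subset \mathrm{Gr}(d,n)\subset\mathbb P^{N-1}$ be the set of $d$-dimensional linear subspaces contained in $X$, and let $\mathrm{trop}(L(X))\subset\mathbb R^{N}/\mathbb R(1,\dots,1)$ be the closure of the set of all $(-\mathrm{val}(x_J))_J$, where $x$ runs over the points of $L(X)$ with all coordinates nonzero. We say that $X$ has constant coefficients if it is the solution set of linear equations with coefficients in a subfield of $K$ on which the valuation is zero (on nonzero elements). For a $(d+1)\times n$ matrix $W$ with rowspace $X$, let $V$ be the $(d+1)\times N$ matrix of the $d\times d$ minors of $W$: its rows are indexed by the row of $W$ that is deleted, and its columns by the $d$-element subsets of $\{1,\dots,n\}$. Whether a given maximal minor of $V$ vanishes depends only on $X$. Let $U\subset \mathrm{Gr}(d+1,n)$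 be the set of all $X$ at which no maximal minor of $V$ vanishes, except for those minors that vanish for every $X\in\mathrm{Gr}(d+1,n)$. Then $U$ is Zariski open and dense in $\mathrm{Gr}(d+1,n)$, and for every infinite subfield $k$ of $K$ the elements of $U$ that are defined by linear equations with coefficients in $k$ are still Zariski dense in $\mathrm{Gr}(d+1,n)$. Moreover, $\mathrm{trop}(L(X))$ is the same for all $X\in U$ with constant coefficients. -/

import Mathlib

open MvPolynomial Module
open scoped LinearAlgebra.Projectivization

noncomputable section

/-- `[n] choose m`: the set of `m`-element subsets of the `n`-element index set. -/
abbrev KSubset (m n : ℕ) : Type := {J : Finset (Fin n) // J.card = m}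

/-- The Grassmannian `Gr(m,n)` of `m`-dimensional linear subspaces of `K^n`. -/
def Gr (K : Type*) [Field K] (m n : ℕ) : Type _ :=
  {X : Submodule K (Fin n → K) // finrank K X = m}

section Pluecker

variable {K : Type*} [Field K] {m n : ℕ}

/-- The maximal minor `det (W_J)` of an `m × n` matrix: the determinant of the square submatrix on
the columns in `J`, taken in increasing order. -/
def maxMinor (W : Matrix (Fin m) (Fin n) K) (J : KSubset m n) : K :=
  (W.submatrix id (J.1.orderEmbOfFin J.2)).det

/-- A matrix with linearly independent rows has a nonzero maximal minor. -/
theorem maxMinor_ne_zero {W : Matrix (Fin m) (Fin n) K} (hW : LinearIndependent K W.row) :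
    maxMinor W ≠ 0 := by
  have hrank : W.rank = m := by
    simpa using hW.rank_matrix
  have htop : Submodule.span K (Set.range W.col) = ⊤ := by
    apply Submodule.eq_top_of_finrank_eq
    rw [← Matrix.rank_eq_finrank_span_cols, hrank]
    simp
  obtain ⟨κ, a, ha, hsp, hli⟩ := exists_linearIndependent' K W.col
  rw [htop] at hsp
  let b : Basis κ K (Fin m → K) := Basis.mk hli hsp.ge
  have : Finite κ := Finite.of_injective a ha
  have : Fintype κ := Fintype.ofFinite κ
  have hcard : Fintype.card κ = m := by
    rw [← finrank_eq_card_basis b]; simp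
  let J : KSubset m n :=
    ⟨Finset.univ.map ⟨a, ha⟩, by rw [Finset.card_map, Finset.card_univ, hcard]⟩
  have hmem : ∀ i : Fin m, ∃ k : κ, a k = J.1.orderEmbOfFin J.2 i := by
    intro i
    have h2 : J.1.orderEmbOfFin J.2 i ∈ Finset.univ.map ⟨a, ha⟩ :=
      Finset.orderEmbOfFin_mem J.1 J.2 i
    obtain ⟨k, -, hk⟩ := Finset.mem_map.1 h2
    exact ⟨k, hk⟩
  choose g hg using hmem
  have hginj : Function.Injective g := by
    intro i j hij
    apply (J.1.orderEmbOfFin J.2).injective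
    rw [← hg i, ← hg j, hij]
  intro h0
  have hdet : (W.submatrix id (J.1.orderEmbOfFin J.2)).det = 0 := congrFun h0 J
  have hcols : LinearIndependent K (W.submatrix id (J.1.orderEmbOfFin J.2)).col := by
    have h1 := hli.comp g hginj
    have h3 : (W.col ∘ a) ∘ g = (W.submatrix id (J.1.orderEmbOfFin J.2)).col := by
      funext i
      simp only [Function.comp_apply, hg i]
      rfl
    rw [← h3]
    exact h1
  have hunit := Matrix.linearIndependent_cols_iff_isUnit.1 hcols
  rw [Matrix.isUnit_iff_isUnit_det] at hunit
  exact hunit.ne_zero hdet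

/-- `W` presents `X`: the subspace `X` is the rowspace of `W`. -/
def Presents (W : Matrix (Fin m) (Fin n) K) (X : Gr K m n) : Prop :=
  Submodule.span K (Set.range W.row) = X.1

/-- A matrix presenting `X`, whose rows are a basis of `X`. -/
def Gr.toMatrix (X : Gr K m n) : Matrix (Fin m) (Fin n) K :=
  haveI : Module.Finite K X.1 := inferInstance
  Matrix.of fun i => ((finBasisOfFinrankEq K X.1 X.2 i : X.1) : Fin n → K)

theorem Gr.linearIndependent_toMatrix (X : Gr K m n) : LinearIndependent K X.toMatrix.row :=
  (finBasisOfFinrankEq K X.1 X.2).linearIndependent.map' X.1.subtype (Submodule.ker_subtype _)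

/-- The Plücker embedding `Gr(m,n) → ℙ^(n choose m - 1)`. The point does not depend on the matrix
chosen to present `X`: another choice multiplies all maximal minors by one nonzero scalar. -/
def pluecker (X : Gr K m n) : ℙ K (KSubset m n → K) :=
  Projectivization.mk K (maxMinor X.toMatrix) (maxMinor_ne_zero X.linearIndependent_toMatrix)

end Pluecker

section Zariski

variable {K : Type*} [Field K]

/-- The distinguished subset `{f ≠ 0}` of projective space. It is meaningful for homogeneous `f`,
for which it does not depend on the representatives. -/
def distinguished {ι : Type*} (f : MvPolynomial ι K) : Set (ℙ K (ι → K)) :=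
  {p | eval p.rep f ≠ 0}

/-- The Zariski topology on projective space: the sets `{f ≠ 0}`, with `f` homogeneous, form a
basis of open sets. -/
@[reducible] def zariskiTopology (K : Type*) [Field K] (ι : Type*) : TopologicalSpace (ℙ K (ι → K)) :=
  TopologicalSpace.generateFrom
    {U | ∃ (e : ℕ) (f : MvPolynomial ι K), f.IsHomogeneous e ∧ U = distinguished f}

/-- The Zariski topology on the Grassmannian, as a subspace of projective space. -/
instance Gr.instTopologicalSpace (m n : ℕ) : TopologicalSpace (Gr K m n) :=
  (zariskiTopology K (KSubset m n)).induced pluecker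

end Zariski

section Coordinates

variable {K : Type*} [Field K] {d n : ℕ}

/-- The `(d+1) × (n choose d)` matrix `V` of the `d × d` minors of a `(d+1) × n` matrix `W`: the
rows of `V` correspond to the deleted row of `W` (the last row of `W` comes first), the columns of
`V` to the `d`-element sets of columns of `W`. -/
def concreteCoordinates (W : Matrix (Fin (d + 1)) (Fin n) K) :
    Matrix (Fin (d + 1)) (KSubset d n) K :=
  Matrix.of fun r J => maxMinor (W.submatrix r.rev.succAbove id) J

/-- The maximal minor of `V` on the `d+1` distinct columns listed by `s`. -/
def coordMinor (W : Matrix (Fin (d + 1)) (Fin n) K) (s : Fin (d + 1) ↪ KSubset d n) : K :=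
  ((concreteCoordinates W).submatrix id s).det

/-- The maximal minor of `V` on the columns `s` is identically zero on `Gr(d+1,n)`. -/
def MinorIdenticallyZero (K : Type*) [Field K] {d n : ℕ} (s : Fin (d + 1) ↪ KSubset d n) : Prop :=
  ∀ (X : Gr K (d + 1) n) (W : Matrix (Fin (d + 1)) (Fin n) K), Presents W X → coordMinor W s = 0

/-- The set of all `X` in `Gr(d+1,n)` at which no maximal minor of `V` vanishes, except for those
that vanish identically on `Gr(d+1,n)`. (Replacing `W` by `gW` multiplies every maximal minor of `V`
by `(det g)^d`, so the choice of the matrix presenting `X` is irrelevant.) -/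
def genericLocus (K : Type*) [Field K] (d n : ℕ) : Set (Gr K (d + 1) n) :=
  {X | ∀ s : Fin (d + 1) ↪ KSubset d n, ¬ MinorIdenticallyZero K s →
    ∀ W : Matrix (Fin (d + 1)) (Fin n) K, Presents W X → coordMinor W s ≠ 0}

/-- `L(X)`: the `d`-dimensional linear subspaces of `K^n` contained in `X`, as a subset of the
projective space of the Plücker embedding of `Gr(d,n)`. -/
def spaceL (X : Gr K (d + 1) n) : Set (ℙ K (KSubset d n → K)) :=
  pluecker '' {L : Gr K d n | L.1 ≤ X.1}

end Coordinates

section Tropical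

variable {K : Type*} [Field K]

/-- The tropical torus `ℝ^ι / ℝ·(1,…,1)`, the tropicalization of the torus of projective space. -/
abbrev TropTorus (ι : Type*) : Type _ := (ι → ℝ) ⧸ Submodule.span ℝ {(1 : ι → ℝ)}

/-- `-val(x)`, coordinatewise, as a real vector; meaningful when all coordinates of `x` are nonzero
and so have finite valuation. -/
def negVal {ι : Type*} (v : AddValuation K (WithTop ℝ)) (x : ι → K) : ι → ℝ :=
  fun i => -(v (x i)).untopD 0

/-- The tropicalization of a subset `Y` of projective space: the closure of the set of all
`-val(x)`, where `x` runs over the points of `Y` in the torus. -/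
def trop {ι : Type*} (v : AddValuation K (WithTop ℝ)) (Y : Set (ℙ K (ι → K))) :
    Set (TropTorus ι) :=
  closure {t | ∃ (x : ι → K) (hx : x ≠ 0), Projectivization.mk K x hx ∈ Y ∧ (∀ i, x i ≠ 0) ∧
    t = Submodule.Quotient.mk (negVal v x)}

/-- `X` is the solution set of linear equations with coefficients in the subfield `k`. -/
def DefinedOver {m n : ℕ} (k : Subfield K) (X : Gr K m n) : Prop :=
  ∃ E : Set (Fin n → K), (∀ a ∈ E, ∀ i, a i ∈ k) ∧ ∀ x, x ∈ X.1 ↔ ∀ a ∈ E, ∑ i, a i * x i = 0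

/-- `X` has constant coefficients: it is defined over a subfield on which the valuation is zero. -/
def HasConstantCoefficients {m n : ℕ} (v : AddValuation K (WithTop ℝ)) (X : Gr K m n) : Prop :=
  ∃ k : Subfield K, (∀ a ∈ k, a ≠ 0 → v a = 0) ∧ DefinedOver k X

end Tropical

end

/-! ### Matrices presenting a subspace, and change of presentation. -/

section Presentations

variable {K : Type*} [Field K] {m n : ℕ}

/-! If `W` presents `X`, the hyperplanes of `X` have Plücker vectors `J ↦ a ⬝ᵥ cofactorVec W J` with
`a ≠ 0` (`mk_mem_spaceL_iff`): `L(X)` is a linear space, and its matroid is that of the vectors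
`cofactorVec W J`. The bases of this matroid are the nonvanishing maximal minors of `V`, so the
matroid is the same for all `X` in the generic locus (`linearIndependent_cofactorVec_iff`).

For constant coefficients the tropicalization depends only on the matroid. Given a point `y` of one
linear space, each set `{g | γ < v (y g)}` is a flat. Over the other, infinite, trivially valued
field there is a linear form vanishing exactly on that flat, and a sum of such forms with
coefficients of valuation `γ` is a point of the other linear space with the same valuations as `y`
(`exists_dotProduct_val_eq`).

Openness: on the chart of a nonzero Plücker coordinate, a normalized matrix has entries that are
linear in the Plücker coordinates. Density: all conditions pull back to nonzero polynomials in the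
matrix entries, whose product is nonzero at some point over an infinite `k`. -/

theorem Presents.linearIndependent {W : Matrix (Fin m) (Fin n) K} {X : Gr K m n}
    (h : Presents W X) : LinearIndependent K W.row := by
  rw [linearIndependent_iff_card_eq_finrank_span, Set.finrank, h, X.2, Fintype.card_fin]

theorem Gr.presents_toMatrix (X : Gr K m n) : Presents X.toMatrix X := by
  have h := (finBasisOfFinrankEq K X.1 X.2).span_eq
  have h2 := congrArg (Submodule.map X.1.subtype) h
  rw [Submodule.map_span, Submodule.map_top, Submodule.range_subtype, ← Set.range_comp] at h2
  exact h2

/-- The point of the Grassmannian presented by a matrix with independent rows. -/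
def rowSpace (W : Matrix (Fin m) (Fin n) K) (h : LinearIndependent K W.row) : Gr K m n :=
  ⟨Submodule.span K (Set.range W.row), by rw [finrank_span_eq_card h, Fintype.card_fin]⟩

theorem presents_rowSpace (W : Matrix (Fin m) (Fin n) K) (h : LinearIndependent K W.row) :
    Presents W (rowSpace W h) := rfl

theorem maxMinor_mul (g : Matrix (Fin m) (Fin m) K) (W : Matrix (Fin m) (Fin n) K) :
    maxMinor (g * W) = g.det • maxMinor W := by
  funext J
  rw [Pi.smul_apply, smul_eq_mul, maxMinor, maxMinor, ← Matrix.det_mul]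
  rfl

theorem exists_eq_mul_of_row_mem {l : ℕ} {W : Matrix (Fin m) (Fin n) K}
    {W' : Matrix (Fin l) (Fin n) K}
    (h : ∀ i, W'.row i ∈ Submodule.span K (Set.range W.row)) :
    ∃ g : Matrix (Fin l) (Fin m) K, W' = g * W := by
  have h1 : ∀ i, ∃ c : Fin m → K, ∑ j, c j • W.row j = W'.row i := fun i =>
    (Submodule.mem_span_range_iff_exists_fun K).1 (h i)
  choose c hc using h1
  refine ⟨Matrix.of c, ?_⟩
  ext i j
  have := congrFun (hc i) j
  simp only [Finset.sum_apply, Pi.smul_apply, smul_eq_mul, Matrix.row] at this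
  rw [Matrix.mul_apply, ← this]
  rfl

theorem eq_of_mul_eq_mul_of_linearIndependent {l : ℕ} {W : Matrix (Fin m) (Fin n) K}
    (hW : LinearIndependent K W.row) {g h : Matrix (Fin l) (Fin m) K} (e : g * W = h * W) :
    g = h := by
  have hinj := Matrix.vecMul_injective_iff.2 hW
  ext i j
  have : g.row i = h.row i := by
    apply hinj
    have := congrArg (fun M : Matrix (Fin l) (Fin n) K => M.row i) e
    simpa [Matrix.row, Matrix.mul_apply_eq_vecMul] using this
  exact congrFun this j

theorem Presents.exists_eq_mul {W W' : Matrix (Fin m) (Fin n) K} {X : Gr K m n}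
    (h : Presents W X) (h' : Presents W' X) :
    ∃ g : Matrix (Fin m) (Fin m) K, IsUnit g.det ∧ W' = g * W := by
  obtain ⟨g, hg⟩ := exists_eq_mul_of_row_mem (W := W) (W' := W') fun i => by
    rw [h, ← h']; exact Submodule.subset_span ⟨i, rfl⟩
  obtain ⟨f, hf⟩ := exists_eq_mul_of_row_mem (W := W') (W' := W) fun i => by
    rw [h', ← h]; exact Submodule.subset_span ⟨i, rfl⟩
  refine ⟨g, ?_, hg⟩
  have : f * g = 1 := by
    apply eq_of_mul_eq_mul_of_linearIndependent h.linearIndependent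
    rw [Matrix.mul_assoc, ← hg, ← hf, Matrix.one_mul]
  have h2 := congrArg Matrix.det this
  rw [Matrix.det_mul, Matrix.det_one] at h2
  exact IsUnit.of_mul_eq_one_right _ h2

theorem Presents.mul {W : Matrix (Fin m) (Fin n) K} {X : Gr K m n}
    (h : Presents W X) {g : Matrix (Fin m) (Fin m) K} (hg : IsUnit g.det) :
    Presents (g * W) X := by
  have key : ∀ (g : Matrix (Fin m) (Fin m) K) (W : Matrix (Fin m) (Fin n) K),
      Submodule.span K (Set.range (g * W).row) ≤ Submodule.span K (Set.range W.row) := by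
    intro g W
    rw [Submodule.span_le]
    rintro _ ⟨i, rfl⟩
    have : (g * W).row i = ∑ j, g i j • W.row j := by
      ext c
      simp [Matrix.row, Matrix.mul_apply]
    rw [this]
    exact Submodule.sum_mem _ fun j _ => Submodule.smul_mem _ _ (Submodule.subset_span ⟨j, rfl⟩)
  refine le_antisymm ((key g W).trans_eq h) ?_
  rw [← h]
  have := key g⁻¹ (g * W)
  rwa [← Matrix.mul_assoc, Matrix.nonsing_inv_mul g hg, Matrix.one_mul] at this

theorem Presents.pluecker_eq {W : Matrix (Fin m) (Fin n) K} {X : Gr K m n} (h : Presents W X) :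
    pluecker X = Projectivization.mk K (maxMinor W) (maxMinor_ne_zero h.linearIndependent) := by
  obtain ⟨g, hg, e⟩ := h.exists_eq_mul X.presents_toMatrix
  rw [pluecker, Projectivization.mk_eq_mk_iff]
  refine ⟨hg.unit, ?_⟩
  rw [e, maxMinor_mul]
  rfl

end Presentations

/-! ### `L(X)` as a linear space. -/

section Augmented

variable {K : Type*} [Field K] {d n : ℕ}

/-- The determinants of the columns `J` of `W`, preceded by the column `a`. -/
def augMinor (W : Matrix (Fin (d + 1)) (Fin n) K) (a : Fin (d + 1) → K) (J : KSubset d n) : K :=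
  (Matrix.of fun i => (Fin.cons (a i) fun j => W i (J.1.orderEmbOfFin J.2 j) :
    Fin (d + 1) → K)).det

/-- The vector of signed `d × d` minors of the columns `J` of `W`. -/
def cofactorVec (W : Matrix (Fin (d + 1)) (Fin n) K) (J : KSubset d n) : Fin (d + 1) → K :=
  fun i => (-1) ^ (i : ℕ) * maxMinor (W.submatrix i.succAbove id) J

/-- Laplace expansion along the added column; it makes `augMinor W a` linear in `a`. -/
theorem augMinor_eq_dotProduct (W : Matrix (Fin (d + 1)) (Fin n) K) (a : Fin (d + 1) → K)
    (J : KSubset d n) : augMinor W a J = a ⬝ᵥ cofactorVec W J := by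
  rw [augMinor, Matrix.det_succ_column_zero, dotProduct]
  refine Finset.sum_congr rfl fun i _ => ?_
  rw [cofactorVec, maxMinor]
  have : (Matrix.of fun i => (Fin.cons (a i) fun j => W i (J.1.orderEmbOfFin J.2 j) :
      Fin (d + 1) → K)).submatrix i.succAbove Fin.succ =
      (W.submatrix i.succAbove id).submatrix id (J.1.orderEmbOfFin J.2) := by
    ext p q
    simp
  rw [this]
  simp
  ring

theorem augMinor_smul (W : Matrix (Fin (d + 1)) (Fin n) K) (c : K) (a : Fin (d + 1) → K) :
    augMinor W (c • a) = c • augMinor W a := by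
  funext J
  simp [augMinor_eq_dotProduct]

theorem augMinor_mul (g : Matrix (Fin (d + 1)) (Fin (d + 1)) K)
    (W : Matrix (Fin (d + 1)) (Fin n) K) (a : Fin (d + 1) → K) :
    augMinor (g * W) (g.mulVec a) = g.det • augMinor W a := by
  funext J
  rw [Pi.smul_apply, smul_eq_mul, augMinor, augMinor, ← Matrix.det_mul]
  congr 1
  ext i j
  refine Fin.cases ?_ (fun j => ?_) j
  · simp [Matrix.mul_apply, Matrix.mulVec, dotProduct]
  · simp [Matrix.mul_apply]

theorem augMinor_single_zero (W : Matrix (Fin (d + 1)) (Fin n) K) :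
    augMinor W (Pi.single 0 1) = maxMinor (W.submatrix Fin.succ id) := by
  funext J
  rw [augMinor_eq_dotProduct, single_one_dotProduct, cofactorVec]
  simp [Fin.succAbove_zero]

theorem exists_det_isUnit_mulVec_single {a : Fin (d + 1) → K} (ha : a ≠ 0) :
    ∃ h : Matrix (Fin (d + 1)) (Fin (d + 1)) K, IsUnit h.det ∧
      h.mulVec (Pi.single 0 1) = a := by
  obtain ⟨p, hp⟩ := Function.ne_iff.1 ha
  -- Putting `a` in column `p` of the identity gives determinant `a p ≠ 0`; the swap then moves that
  -- column to position `0`.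
  refine ⟨((1 : Matrix (Fin (d + 1)) (Fin (d + 1)) K).updateCol p a).submatrix id
    (Equiv.swap 0 p), ?_, ?_⟩
  · rw [Matrix.det_permute']
    have : ((1 : Matrix (Fin (d + 1)) (Fin (d + 1)) K).updateCol p a).det = a p := by
      rw [← Matrix.cramer_apply, Matrix.cramer_one]; rfl
    rw [this, isUnit_iff_ne_zero]
    refine mul_ne_zero ?_ hp
    exact ((Equiv.Perm.sign (Equiv.swap 0 p)).isUnit.map (Int.castRingHom K)).ne_zero
  · ext i
    simp

theorem coordMinor_eq_zero_iff (W : Matrix (Fin (d + 1)) (Fin n) K)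
    (s : Fin (d + 1) ↪ KSubset d n) :
    coordMinor W s = 0 ↔ ∃ a ≠ 0, ∀ j, augMinor W a (s j) = 0 := by
  rw [coordMinor, ← Matrix.exists_vecMul_eq_zero_iff]
  -- The rows of `V` are unsigned and in reverse order, those of the cofactor vectors signed and in
  -- order; this substitution matches the two.
  have key : ∀ b : Fin (d + 1) → K, ∀ j,
      Matrix.vecMul b ((concreteCoordinates W).submatrix id s) j =
        augMinor W (fun i => (-1) ^ (i : ℕ) * b i.rev) (s j) := by
    intro b j
    rw [augMinor_eq_dotProduct, Matrix.vecMul, dotProduct, dotProduct,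
      ← Equiv.sum_comp Fin.revPerm]
    refine Finset.sum_congr rfl fun i _ => ?_
    simp only [Fin.revPerm_apply, concreteCoordinates, Matrix.submatrix_apply, id,
      Matrix.of_apply, Fin.rev_rev, cofactorVec]
    have : ((-1 : K) ^ (i : ℕ)) * (-1) ^ (i : ℕ) = 1 := by
      rw [← mul_pow]; simp
    linear_combination (-b i.rev * maxMinor (W.submatrix i.succAbove id) (s j)) * this
  constructor
  · rintro ⟨b, hb, h⟩
    refine ⟨_, fun h0 => hb ?_, fun j => (key b j).symm.trans (congrFun h j)⟩
    funext i
    have := congrFun h0 i.rev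
    simpa using this
  · rintro ⟨a, ha, h⟩
    refine ⟨fun i => (-1) ^ (i.rev : ℕ) * a i.rev, fun h0 => ha ?_, ?_⟩
    · funext i
      have := congrFun h0 i.rev
      simpa using this
    · funext j
      rw [key]
      have : (fun i : Fin (d + 1) => (-1 : K) ^ (i : ℕ) *
          ((-1) ^ (i.rev.rev : ℕ) * a i.rev.rev)) = a := by
        funext i
        rw [Fin.rev_rev, ← mul_assoc, ← mul_pow]; simp
      rw [this]
      exact h j

theorem coordMinor_mul_eq_zero_iff (W : Matrix (Fin (d + 1)) (Fin n) K)
    {g : Matrix (Fin (d + 1)) (Fin (d + 1)) K} (hg : IsUnit g.det)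
    (s : Fin (d + 1) ↪ KSubset d n) : coordMinor (g * W) s = 0 ↔ coordMinor W s = 0 := by
  have key : ∀ (W : Matrix (Fin (d + 1)) (Fin n) K)
      {g : Matrix (Fin (d + 1)) (Fin (d + 1)) K}, IsUnit g.det →
      coordMinor W s = 0 → coordMinor (g * W) s = 0 := by
    intro W g hg h
    rw [coordMinor_eq_zero_iff] at h ⊢
    obtain ⟨a, ha, h⟩ := h
    refine ⟨g.mulVec a, fun h0 => ha ?_, fun j => ?_⟩
    · rw [← Matrix.one_mulVec a, ← Matrix.nonsing_inv_mul g hg, ← Matrix.mulVec_mulVec, h0,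
        Matrix.mulVec_zero]
    · rw [augMinor_mul, Pi.smul_apply, h j, smul_zero]
  refine ⟨fun h => ?_, key W hg⟩
  have := key (g * W) (Matrix.isUnit_nonsing_inv_det g hg) h
  rwa [← Matrix.mul_assoc, Matrix.nonsing_inv_mul g hg, Matrix.one_mul] at this

theorem coordMinor_eq_zero_iff_not_linearIndependent (W : Matrix (Fin (d + 1)) (Fin n) K)
    (s : Fin (d + 1) ↪ KSubset d n) :
    coordMinor W s = 0 ↔ ¬ LinearIndependent K (cofactorVec W ∘ s) := by
  rw [coordMinor_eq_zero_iff]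
  have h1 := Matrix.exists_mulVec_eq_zero_iff (M := Matrix.of (cofactorVec W ∘ s))
  have h2 := Matrix.linearIndependent_rows_iff_isUnit (A := Matrix.of (cofactorVec W ∘ s))
  rw [Matrix.isUnit_iff_isUnit_det, isUnit_iff_ne_zero, ne_eq, ← h1] at h2
  change _ ↔ ¬ LinearIndependent K (Matrix.of (cofactorVec W ∘ s)).row
  rw [h2, not_not]
  simp only [augMinor_eq_dotProduct, funext_iff, Matrix.mulVec, dotProduct_comm]
  rfl

theorem mem_genericLocus_iff {W : Matrix (Fin (d + 1)) (Fin n) K} {X : Gr K (d + 1) n}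
    (h : Presents W X) : X ∈ genericLocus K d n ↔
      ∀ s : Fin (d + 1) ↪ KSubset d n, ¬ MinorIdenticallyZero K s → coordMinor W s ≠ 0 := by
  refine ⟨fun hX s hs => hX s hs W h, fun hX s hs W' h' h0 => hX s hs ?_⟩
  obtain ⟨g, hg, rfl⟩ := h.exists_eq_mul h'
  exact (coordMinor_mul_eq_zero_iff W hg s).1 h0

/-- A change of basis moves `a` to the first unit vector, where `augMinor` is the Plücker vector of
the remaining `d` rows, which are independent. -/
theorem augMinor_ne_zero {W : Matrix (Fin (d + 1)) (Fin n) K} (hW : LinearIndependent K W.row)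
    {a : Fin (d + 1) → K} (ha : a ≠ 0) : augMinor W a ≠ 0 := by
  obtain ⟨h, hh, rfl⟩ := exists_det_isUnit_mulVec_single ha
  have hP := (presents_rowSpace W hW).mul (Matrix.isUnit_nonsing_inv_det h hh)
  have e : W = h * (h⁻¹ * W) := by
    rw [← Matrix.mul_assoc, Matrix.mul_nonsing_inv h hh, Matrix.one_mul]
  rw [e, augMinor_mul, augMinor_single_zero]
  refine smul_ne_zero hh.ne_zero (maxMinor_ne_zero ?_)
  exact hP.linearIndependent.comp _ (Fin.succ_injective d)

theorem dual_apply_eq_dotProduct {r : ℕ} (f : Dual K (Fin r → K)) (x : Fin r → K) :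
    f x = (fun i => f (Pi.single i 1)) ⬝ᵥ x := by
  conv_lhs => rw [← Finset.univ_sum_single x, map_sum]
  refine Finset.sum_congr rfl fun i _ => ?_
  have : Pi.single i (x i) = x i • (Pi.single i 1 : Fin r → K) := by
    rw [← Pi.single_smul, smul_eq_mul, mul_one]
  rw [this, map_smul, smul_eq_mul, mul_comm]

/-- A linear form killing all cofactor vectors would be a nonzero `a` with `augMinor W a = 0`. -/
theorem span_cofactorVec {W : Matrix (Fin (d + 1)) (Fin n) K} (hW : LinearIndependent K W.row) :
    Submodule.span K (Set.range (cofactorVec W)) = ⊤ := by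
  by_contra h
  obtain ⟨f, hf, hle⟩ := Submodule.exists_le_ker_of_lt_top _ (lt_top_iff_ne_top.2 h)
  refine augMinor_ne_zero hW (a := fun i => f (Pi.single i 1)) ?_ ?_
  · intro h0
    apply hf
    ext x
    simpa using congrFun h0 x
  · funext J
    rw [augMinor_eq_dotProduct, ← dual_apply_eq_dotProduct]
    exact hle (Submodule.subset_span ⟨J, rfl⟩)

theorem mk_mem_spaceL_iff {W : Matrix (Fin (d + 1)) (Fin n) K} {X : Gr K (d + 1) n}
    (h : Presents W X) {x : KSubset d n → K} (hx : x ≠ 0) :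
    Projectivization.mk K x hx ∈ spaceL X ↔ ∃ a, x = augMinor W a := by
  constructor
  · rintro ⟨L, hL, e⟩
    rw [L.presents_toMatrix.pluecker_eq, Projectivization.mk_eq_mk_iff] at e
    obtain ⟨c, hc⟩ := e
    have hLt : L.1 < X.1 := lt_of_le_of_ne hL fun he => by
      have h1 := L.2
      have h2 := X.2
      rw [he] at h1
      omega
    obtain ⟨u, huX, huL⟩ := SetLike.exists_of_lt hLt
    -- A basis of `L` is completed to one of `X` by a first row `u`, so that the Plücker vector of
    -- `L` is the `augMinor` of the first unit vector.
    let W' : Matrix (Fin (d + 1)) (Fin n) K := Matrix.of (Fin.cons u L.toMatrix)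
    have hli : LinearIndependent K W'.row := by
      change LinearIndependent K (Fin.cons u L.toMatrix.row)
      rw [linearIndependent_finCons]
      refine ⟨L.linearIndependent_toMatrix, ?_⟩
      rwa [L.presents_toMatrix]
    have hP : Presents W' X := by
      apply Submodule.eq_of_le_of_finrank_eq
      · rw [Submodule.span_le]
        rintro _ ⟨i, rfl⟩
        refine Fin.cases huX (fun i => ?_) i
        apply hL
        have : L.toMatrix.row i ∈ Submodule.span K (Set.range L.toMatrix.row) :=
          Submodule.subset_span ⟨i, rfl⟩
        rwa [L.presents_toMatrix] at this
      · rw [X.2, finrank_span_eq_card hli, Fintype.card_fin]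
    obtain ⟨g, hg, e⟩ := h.exists_eq_mul hP
    have hmul := augMinor_mul g W (g⁻¹.mulVec (Pi.single 0 1))
    rw [Matrix.mulVec_mulVec, Matrix.mul_nonsing_inv g hg, Matrix.one_mulVec, ← e,
      augMinor_single_zero] at hmul
    have hW' : W'.submatrix Fin.succ id = L.toMatrix := rfl
    rw [hW', ← hc] at hmul
    refine ⟨((c⁻¹ : Kˣ) : K) • g.det • g⁻¹.mulVec (Pi.single 0 1), ?_⟩
    rw [augMinor_smul, augMinor_smul, ← hmul]
    exact (inv_smul_smul c x).symm
  · rintro ⟨a, rfl⟩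
    have ha : a ≠ 0 := by
      rintro rfl
      apply hx
      funext J
      simp [augMinor_eq_dotProduct]
    -- In the basis where `a` is the first unit vector, the required hyperplane of `X` is spanned by
    -- all rows but the first.
    obtain ⟨g, hg, rfl⟩ := exists_det_isUnit_mulVec_single ha
    have hP := h.mul (Matrix.isUnit_nonsing_inv_det g hg)
    set W' := g⁻¹ * W with hW'
    have e : W = g * W' := by
      rw [hW', ← Matrix.mul_assoc, Matrix.mul_nonsing_inv g hg, Matrix.one_mul]
    have hli : LinearIndependent K (W'.submatrix Fin.succ id).row :=
      hP.linearIndependent.comp _ (Fin.succ_injective d)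
    refine ⟨rowSpace _ hli, ?_, ?_⟩
    · change Submodule.span K _ ≤ X.1
      rw [← hP]
      apply Submodule.span_mono
      rintro _ ⟨i, rfl⟩
      exact ⟨i.succ, rfl⟩
    · rw [(presents_rowSpace _ hli).pluecker_eq, Projectivization.mk_eq_mk_iff]
      refine ⟨hg.unit⁻¹, ?_⟩
      rw [inv_smul_eq_iff]
      have := augMinor_mul g W' (Pi.single 0 1)
      rw [← e, augMinor_single_zero] at this
      exact this

end Augmented

/-! ### Homogeneous polynomials on projective space. -/

section Homogeneous

variable {K : Type*} [Field K]

theorem MvPolynomial.IsHomogeneous.eval_const_smul {ι : Type*} {f : MvPolynomial ι K} {e : ℕ}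
    (hf : f.IsHomogeneous e) (c : K) (x : ι → K) : eval (c • x) f = c ^ e * eval x f := by
  rw [eval_eq, eval_eq, Finset.mul_sum]
  refine Finset.sum_congr rfl fun s hs => ?_
  simp only [Pi.smul_apply, smul_eq_mul, mul_pow, Finset.prod_mul_distrib,
    Finset.prod_pow_eq_pow_sum]
  rw [← hf.degree_eq_sum_deg_support hs]
  ring

theorem mk_mem_distinguished_iff {ι : Type*} {f : MvPolynomial ι K} {e : ℕ}
    (hf : f.IsHomogeneous e) {x : ι → K} (hx : x ≠ 0) :
    Projectivization.mk K x hx ∈ distinguished f ↔ eval x f ≠ 0 := by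
  obtain ⟨a, ha⟩ := Projectivization.exists_smul_eq_mk_rep K x hx
  change eval (Projectivization.mk K x hx).rep f ≠ 0 ↔ _
  rw [← ha, Units.smul_def, hf.eval_const_smul]
  simp

theorem Matrix.isHomogeneous_det {ι : Type*} {m e : ℕ}
    {M : Matrix (Fin m) (Fin m) (MvPolynomial ι K)} (hM : ∀ i j, (M i j).IsHomogeneous e) :
    M.det.IsHomogeneous (m * e) := by
  rw [Matrix.det_apply']
  refine IsHomogeneous.sum _ _ _ fun σ _ => ?_
  have h1 : (∏ i, M (σ i) i).IsHomogeneous (∑ _i : Fin m, e) :=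
    IsHomogeneous.prod _ _ _ fun i _ => hM _ _
  have h2 := h1.C_mul (((Equiv.Perm.sign σ : ℤˣ) : ℤ) : K)
  simpa using h2

end Homogeneous

/-! ### Plücker charts and openness of the generic locus. -/

section Charts

variable {K : Type*} [Field K] {m n d : ℕ}

/-- Up to sign, a minor with columns in any order is a coordinate of the Plücker vector. -/
theorem exists_linearForm_eval_eq_det (c : Fin m → Fin n) :
    ∃ l : MvPolynomial (KSubset m n) K, l.IsHomogeneous 1 ∧
      ∀ W : Matrix (Fin m) (Fin n) K, eval (maxMinor W) l = (W.submatrix id c).det := by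
  by_cases hc : Function.Injective c
  · let J : KSubset m n := ⟨Finset.univ.map ⟨c, hc⟩, by simp⟩
    have hmem : ∀ i, ∃ p, J.1.orderEmbOfFin J.2 p = c i := by
      intro i
      have h1 : c i ∈ Set.range (J.1.orderEmbOfFin J.2) := by
        rw [Finset.range_orderEmbOfFin]
        simp [J]
      exact h1
    choose σ hσ using hmem
    have hinj : Function.Injective σ := fun i j h => hc (by rw [← hσ, ← hσ, h])
    let τ : Equiv.Perm (Fin m) := Equiv.ofBijective σ (Finite.injective_iff_bijective.1 hinj)
    refine ⟨C (((Equiv.Perm.sign τ : ℤˣ) : ℤ) : K) * X J, isHomogeneous_C_mul_X _ _, fun W => ?_⟩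
    have : W.submatrix id c = (W.submatrix id (J.1.orderEmbOfFin J.2)).submatrix id τ := by
      ext i j
      simp [τ, hσ]
    rw [this, Matrix.det_permute']
    simp [maxMinor]
  · refine ⟨0, isHomogeneous_zero _ _ _, fun W => ?_⟩
    rw [map_zero]
    simp only [Function.Injective, not_forall] at hc
    obtain ⟨i, j, h, hij⟩ := hc
    exact (Matrix.det_zero_of_column_eq hij fun r => by simp [h]).symm

/-- The square submatrix on the columns in `J`. -/
abbrev chartBlock (W : Matrix (Fin m) (Fin n) K) (J : KSubset m n) : Matrix (Fin m) (Fin m) K :=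
  W.submatrix id (J.1.orderEmbOfFin J.2)

/-- Cramer's rule. The entries of the normalized matrix are minors of `W`, hence linear forms in the
Plücker coordinates. -/
theorem adjugate_mul_apply (W : Matrix (Fin m) (Fin n) K) (J : KSubset m n) (i : Fin m)
    (c : Fin n) : ((chartBlock W J).adjugate * W) i c =
      (W.submatrix id (Function.update (J.1.orderEmbOfFin J.2) i c)).det := by
  have h1 : ((chartBlock W J).adjugate * W) i c =
      ((chartBlock W J).adjugate.mulVec (W.col c)) i := rfl
  rw [h1, ← Matrix.cramer_eq_adjugate_mulVec, Matrix.cramer_apply]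
  congr 1
  ext p q
  by_cases h : q = i
  · subst h; simp [Matrix.col]
  · simp [h]

/-- The polynomial expression for `coordMinor`, over any commutative ring. -/
def coordMinorOver {R : Type*} [CommRing R] (W : Matrix (Fin (d + 1)) (Fin n) R)
    (s : Fin (d + 1) ↪ KSubset d n) : R :=
  (Matrix.of fun r j =>
    (W.submatrix (r.rev.succAbove) ((s j).1.orderEmbOfFin (s j).2)).det).det

theorem map_coordMinorOver {R : Type*} [CommRing R] (f : R →+* K)
    (W : Matrix (Fin (d + 1)) (Fin n) R) (s : Fin (d + 1) ↪ KSubset d n) :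
    f (coordMinorOver W s) = coordMinor (W.map f) s := by
  rw [coordMinorOver, RingHom.map_det, coordMinor]
  congr 1
  ext r j
  simp only [RingHom.mapMatrix_apply, Matrix.map_apply, Matrix.of_apply, RingHom.map_det]
  rfl

theorem isHomogeneous_coordMinorOver {ι : Type*} {e : ℕ}
    {W : Matrix (Fin (d + 1)) (Fin n) (MvPolynomial ι K)} (hW : ∀ i j, (W i j).IsHomogeneous e)
    (s : Fin (d + 1) ↪ KSubset d n) :
    (coordMinorOver W s).IsHomogeneous ((d + 1) * (d * e)) :=
  Matrix.isHomogeneous_det fun _ _ => Matrix.isHomogeneous_det fun _ _ => hW _ _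

/-- Normalizing by the adjugate, rather than the inverse, keeps everything polynomial in the Plücker
coordinates. -/
theorem exists_isHomogeneous_eval_eq_coordMinor (J : KSubset (d + 1) n)
    (s : Fin (d + 1) ↪ KSubset d n) :
    ∃ (f : MvPolynomial (KSubset (d + 1) n) K) (e : ℕ), f.IsHomogeneous e ∧
      ∀ W : Matrix (Fin (d + 1)) (Fin n) K,
        eval (maxMinor W) f = coordMinor ((chartBlock W J).adjugate * W) s := by
  choose l hl hlW using fun (i : Fin (d + 1)) (c : Fin n) =>
    exists_linearForm_eval_eq_det (K := K) (Function.update (J.1.orderEmbOfFin J.2) i c)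
  refine ⟨coordMinorOver (Matrix.of l) s, _, isHomogeneous_coordMinorOver (fun i j => hl i j) s,
    fun W => ?_⟩
  rw [map_coordMinorOver]
  congr 1
  ext i c
  rw [adjugate_mul_apply, ← hlW]
  rfl

theorem isOpen_preimage_distinguished {f : MvPolynomial (KSubset m n) K} {e : ℕ}
    (hf : f.IsHomogeneous e) : IsOpen (pluecker ⁻¹' distinguished f : Set (Gr K m n)) :=
  letI := zariskiTopology K (KSubset m n)
  isOpen_induced_iff.2 ⟨_, TopologicalSpace.isOpen_generateFrom_of_mem ⟨e, f, hf, rfl⟩, rfl⟩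

theorem isOpen_genericLocus (K : Type*) [Field K] (d n : ℕ) : IsOpen (genericLocus K d n) := by
  choose F e hF hFW using fun (J : KSubset (d + 1) n) (s : Fin (d + 1) ↪ KSubset d n) =>
    exists_isHomogeneous_eval_eq_coordMinor (K := K) J s
  -- The factor `X J` restricts to the chart where the adjugate is invertible, so that the
  -- normalization does not affect vanishing.
  have key : genericLocus K d n = ⋂ s : Fin (d + 1) ↪ KSubset d n,
      ⋂ _ : ¬ MinorIdenticallyZero K s, ⋃ J : KSubset (d + 1) n,
        pluecker ⁻¹' distinguished (X J * F J s) := by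
    ext X
    have hP := X.presents_toMatrix
    rw [mem_genericLocus_iff hP]
    simp only [Set.mem_iInter, Set.mem_iUnion, Set.mem_preimage]
    refine forall_congr' fun s => forall_congr' fun _ => ?_
    have hiff : ∀ J, pluecker X ∈ distinguished (MvPolynomial.X J * F J s) ↔
        maxMinor X.toMatrix J ≠ 0 ∧ coordMinor X.toMatrix s ≠ 0 := by
      intro J
      rw [hP.pluecker_eq, mk_mem_distinguished_iff ((isHomogeneous_X K J).mul (hF J s)), map_mul,
        eval_X, hFW, mul_ne_zero_iff]
      refine and_congr_right fun hJ => not_congr (coordMinor_mul_eq_zero_iff _ ?_ s)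
      rw [Matrix.det_adjugate]
      exact (isUnit_iff_ne_zero.2 hJ).pow _
    simp only [hiff]
    refine ⟨fun h => ?_, fun ⟨_, h⟩ => h.2⟩
    obtain ⟨J, hJ⟩ := Function.ne_iff.1 (maxMinor_ne_zero hP.linearIndependent)
    exact ⟨J, hJ, h⟩
  rw [key]
  refine isOpen_iInter_of_finite fun s => isOpen_iInter_of_finite fun _ => isOpen_iUnion fun J =>
    isOpen_preimage_distinguished ((isHomogeneous_X K J).mul (hF J s))

end Charts

/-! ### Equations over a subfield and presentations over it. -/

section DefinedOver

variable {K : Type*} [Field K] {m n : ℕ}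

theorem Presents.mem_iff {B : Matrix (Fin m) (Fin n) K} {X : Gr K m n} (h : Presents B X)
    {J : KSubset m n} (hJ : chartBlock B J = 1) (x : Fin n → K) :
    x ∈ X.1 ↔ ∀ c, x c = ∑ j, x (J.1.orderEmbOfFin J.2 j) * B j c := by
  rw [← h, Submodule.mem_span_range_iff_exists_fun]
  constructor
  · rintro ⟨a, rfl⟩ c
    have h1 : ∀ i j, B i (J.1.orderEmbOfFin J.2 j) = (1 : Matrix (Fin m) (Fin m) K) i j :=
      fun i j => congrFun (congrFun hJ i) j
    simp [Matrix.row, h1, Matrix.one_apply]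
  · intro hx
    refine ⟨fun j => x (J.1.orderEmbOfFin J.2 j), ?_⟩
    funext c
    rw [hx c]
    simp [Matrix.row]

/-- A subspace has a presentation which is the identity on some set of columns, by a matrix
over any field over which it has a presentation. -/
theorem exists_presents_chartBlock_eq_one {F : Type*} [Field F] (f : F →+* K)
    {W : Matrix (Fin m) (Fin n) F} {X : Gr K m n} (h : Presents (W.map f) X) :
    ∃ (B : Matrix (Fin m) (Fin n) F) (J : KSubset m n), Presents (B.map f) X ∧
      chartBlock B J = 1 := by
  obtain ⟨J, hJ⟩ := Function.ne_iff.1 (maxMinor_ne_zero h.linearIndependent)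
  have hdet : maxMinor (W.map f) J = f (chartBlock W J).det := by
    rw [RingHom.map_det]; rfl
  have hu : IsUnit (chartBlock W J).det := by
    rw [isUnit_iff_ne_zero]
    intro h0
    rw [hdet, h0, map_zero] at hJ
    exact hJ rfl
  refine ⟨(chartBlock W J)⁻¹ * W, J, ?_, ?_⟩
  · rw [Matrix.map_mul]
    apply h.mul
    have := (Matrix.isUnit_nonsing_inv_det _ hu).map f
    rwa [RingHom.map_det] at this
  · exact Matrix.nonsing_inv_mul _ hu

theorem definedOver_of_presents {k : Subfield K} {W : Matrix (Fin m) (Fin n) k} {X : Gr K m n}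
    (h : Presents (W.map k.subtype) X) : DefinedOver k X := by
  obtain ⟨B, J, hB, hJ⟩ := exists_presents_chartBlock_eq_one _ h
  have hJ' : chartBlock (B.map k.subtype) J = 1 := by
    have : chartBlock (B.map k.subtype) J = (chartBlock B J).map k.subtype := rfl
    rw [this, hJ, Matrix.map_one _ (map_zero _) (map_one _)]
  refine ⟨Set.range fun c : Fin n => fun i =>
    ((Pi.single c 1 - ∑ j, B j c • Pi.single (J.1.orderEmbOfFin J.2 j) 1 : Fin n → k) i : K),
    ?_, fun x => ?_⟩
  · rintro _ ⟨c, rfl⟩ i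
    exact SetLike.coe_mem _
  · rw [hB.mem_iff hJ', Set.forall_mem_range]
    refine forall_congr' fun c => ?_
    have : ∑ i, ((Pi.single c 1 - ∑ j, B j c • Pi.single (J.1.orderEmbOfFin J.2 j) 1 :
        Fin n → k) i : K) * x i =
        x c - ∑ j, x (J.1.orderEmbOfFin J.2 j) * B.map k.subtype j c := by
      simp only [Pi.sub_apply, Finset.sum_apply, Pi.smul_apply, smul_eq_mul,
        Subfield.coe_sub, AddSubmonoidClass.coe_finsetSum, Subfield.coe_mul, sub_mul,
        Finset.sum_sub_distrib, Finset.sum_mul]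
      congr 1
      · rw [Finset.sum_eq_single c] <;> simp +contextual
      · rw [Finset.sum_comm]
        refine Finset.sum_congr rfl fun j _ => ?_
        rw [Finset.sum_eq_single (J.1.orderEmbOfFin J.2 j)]
        · simp [mul_comm]
        · intro i _ hi
          simp [hi]
        · simp
    rw [this, sub_eq_zero]

/-- The presentation that is the identity on the columns `J` is unique. A `k`-linear retraction `K →
k` preserves the equations of `X` and the entries `0` and `1`, so it fixes this matrix, whose
entries therefore lie in `k`. -/
theorem DefinedOver.exists_presents {k : Subfield K} {X : Gr K m n} (h : DefinedOver k X) :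
    ∃ W : Matrix (Fin m) (Fin n) k, Presents (W.map k.subtype) X := by
  obtain ⟨E, hE, hX⟩ := h
  obtain ⟨B, J, hB, hJ⟩ := exists_presents_chartBlock_eq_one (RingHom.id K)
    (W := X.toMatrix) X.presents_toMatrix
  replace hB : Presents B X := hB
  obtain ⟨φ, hφ⟩ := (Algebra.linearMap k K).exists_leftInverse_of_injective
    (LinearMap.ker_eq_bot.2 (algebraMap k K).injective)
  have hφ1 : φ 1 = 1 := by
    have := congrArg (fun f => f 1) hφ
    simpa using this
  have hφB : ∀ i c, ((φ (B i c) : k) : K) = B i c := by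
    intro i
    have hrow : B.row i ∈ X.1 := by rw [← hB]; exact Submodule.subset_span ⟨i, rfl⟩
    have hmem : (fun c => ((φ (B i c) : k) : K)) ∈ X.1 := by
      rw [hX] at hrow ⊢
      intro a ha
      have h1 := congrArg (fun z => ((φ z : k) : K)) (hrow a ha)
      simp only [map_zero, map_sum, AddSubmonoidClass.coe_finsetSum, ZeroMemClass.coe_zero] at h1
      rw [← h1]
      refine Finset.sum_congr rfl fun c _ => ?_
      have : a c * B.row i c = (⟨a c, hE a ha c⟩ : k) • B i c := rfl
      rw [this, map_smul]
      rfl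
    rw [hB.mem_iff hJ] at hmem
    intro c
    rw [hmem c]
    have h1 : ∀ j, B i (J.1.orderEmbOfFin J.2 j) = (1 : Matrix (Fin m) (Fin m) K) i j :=
      fun j => congrFun (congrFun hJ i) j
    rw [Finset.sum_eq_single i]
    · simp [h1, hφ1]
    · intro j _ hj
      simp [h1, hj.symm]
    · simp
  refine ⟨Matrix.of fun i c => φ (B i c), ?_⟩
  have : (Matrix.of fun i c => φ (B i c)).map k.subtype = B := by
    ext i c
    exact hφB i c
  rw [this]
  exact hB

end DefinedOver

/-! ### Density of the generic points over an infinite subfield. -/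

section Density

variable {K : Type*} [Field K] {m n d : ℕ}

theorem MvPolynomial.exists_mem_eval_ne_zero {σ : Type*} {k : Subfield K} (hk : Infinite k)
    {P : MvPolynomial σ K} (hP : P ≠ 0) : ∃ w : σ → k, eval (fun i => (w i : K)) P ≠ 0 := by
  by_contra! h
  refine hP (funext_set (fun _ => (k : Set K)) (fun _ => Set.infinite_coe_iff.1 hk) fun x hx => ?_)
  rw [map_zero]
  exact h fun i => ⟨x i, hx i (Set.mem_univ i)⟩

/-- The evaluation of polynomials in the entries of a matrix. -/
def evalMatrix (W : Matrix (Fin m) (Fin n) K) : MvPolynomial (Fin m × Fin n) K →+* K :=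
  eval fun p => W p.1 p.2

theorem map_genericMatrix (W : Matrix (Fin m) (Fin n) K) :
    (Matrix.of fun i j => (X (i, j) : MvPolynomial (Fin m × Fin n) K)).map (evalMatrix W) = W := by
  ext i j
  simp [evalMatrix]

theorem exists_evalMatrix_eq_eval_maxMinor (f : MvPolynomial (KSubset m n) K) :
    ∃ P : MvPolynomial (Fin m × Fin n) K, ∀ W, evalMatrix W P = eval (maxMinor W) f := by
  refine ⟨aeval (fun J : KSubset m n => ((Matrix.of fun i j =>
    (X (i, j) : MvPolynomial (Fin m × Fin n) K)).submatrix id (J.1.orderEmbOfFin J.2)).det) f,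
    fun W => ?_⟩
  have h1 : ∀ J : KSubset m n, evalMatrix W ((Matrix.of fun i j =>
      (X (i, j) : MvPolynomial (Fin m × Fin n) K)).submatrix id (J.1.orderEmbOfFin J.2)).det =
      maxMinor W J := by
    intro J
    rw [RingHom.map_det, maxMinor]
    congr 1
    ext i j
    simp [evalMatrix]
  have h2 : (evalMatrix W).comp (algebraMap K (MvPolynomial (Fin m × Fin n) K)) =
      RingHom.id K := by
    ext c
    simp [evalMatrix, algebraMap_eq]
  rw [map_aeval, h2]
  simp only [h1]
  rfl

theorem dense_definedOver {k : Subfield K} (hk : Infinite k) :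
    Dense {X ∈ genericLocus K d n | DefinedOver k X} := by
  have hB := TopologicalSpace.isTopologicalBasis_of_subbasis
    (t := Gr.instTopologicalSpace (K := K) (d + 1) n) induced_generateFrom_eq
  rw [hB.dense_iff]
  rintro _ ⟨𝒰, ⟨hfin, hsub⟩, rfl⟩ ⟨X₀, hX₀⟩
  have hP₀ := X₀.presents_toMatrix
  have h1 : ∀ U ∈ 𝒰, ∃ P : MvPolynomial (Fin (d + 1) × Fin n) K, P ≠ 0 ∧
      ∀ W X, Presents W X → evalMatrix W P ≠ 0 → X ∈ U := by
    intro U hU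
    obtain ⟨_, ⟨e, f, hf, rfl⟩, rfl⟩ := hsub hU
    obtain ⟨P, hP⟩ := exists_evalMatrix_eq_eval_maxMinor f
    have hiff : ∀ W X, Presents W X →
        (X ∈ pluecker ⁻¹' distinguished f ↔ evalMatrix W P ≠ 0) := by
      intro W X hWX
      rw [Set.mem_preimage, hWX.pluecker_eq, mk_mem_distinguished_iff hf, hP]
    refine ⟨P, ?_, fun W X hWX => (hiff W X hWX).2⟩
    rintro rfl
    exact (hiff _ _ hP₀).1 (hX₀ _ hU) (map_zero _)
  have h2 : ∀ s : Fin (d + 1) ↪ KSubset d n, ∃ P : MvPolynomial (Fin (d + 1) × Fin n) K, P ≠ 0 ∧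
      ∀ W, evalMatrix W P ≠ 0 → ¬ MinorIdenticallyZero K s → coordMinor W s ≠ 0 := by
    intro s
    by_cases hs : MinorIdenticallyZero K s
    · exact ⟨1, one_ne_zero, fun _ _ h => absurd hs h⟩
    · have hev : ∀ W : Matrix (Fin (d + 1)) (Fin n) K, evalMatrix W (coordMinorOver (Matrix.of fun i j => X (i, j)) s) =
          coordMinor W s := fun W => by rw [map_coordMinorOver, map_genericMatrix]
      refine ⟨coordMinorOver (Matrix.of fun i j => X (i, j)) s, ?_, fun W hW _ => hev W ▸ hW⟩
      intro h0
      apply hs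
      intro X W _
      rw [← hev, h0, map_zero]
  -- `Q` is a maximal minor not vanishing at `X₀`; keeping it nonzero makes the rows of the new
  -- matrix independent.
  obtain ⟨J, hJ⟩ := Function.ne_iff.1 (maxMinor_ne_zero hP₀.linearIndependent)
  obtain ⟨Q, hQ⟩ := exists_evalMatrix_eq_eval_maxMinor (X J : MvPolynomial (KSubset (d + 1) n) K)
  have hQ0 : Q ≠ 0 := by
    rintro rfl
    have := hQ X₀.toMatrix
    rw [map_zero, eval_X] at this
    exact hJ this.symm
  choose! A hA0 hA using h1
  choose S hS0 hS using h2
  obtain ⟨w, hw⟩ := MvPolynomial.exists_mem_eval_ne_zero hk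
    (P := Q * ((∏ U ∈ hfin.toFinset, A U) * ∏ s, S s)) (mul_ne_zero hQ0 (mul_ne_zero
      (Finset.prod_ne_zero_iff.2 fun U hU => hA0 U (hfin.mem_toFinset.1 hU))
      (Finset.prod_ne_zero_iff.2 fun s _ => hS0 s)))
  let W : Matrix (Fin (d + 1)) (Fin n) k := Matrix.of fun i j => w (i, j)
  have hw' : evalMatrix (W.map k.subtype) (Q * ((∏ U ∈ hfin.toFinset, A U) * ∏ s, S s)) ≠ 0 := hw
  rw [map_mul, map_mul, map_prod, map_prod, mul_ne_zero_iff, mul_ne_zero_iff,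
    Finset.prod_ne_zero_iff, Finset.prod_ne_zero_iff] at hw'
  obtain ⟨hQw, hAw, hSw⟩ := hw'
  have hli : LinearIndependent K (W.map k.subtype).row := by
    rw [hQ, eval_X] at hQw
    apply LinearIndependent.of_comp (LinearMap.funLeft K K (J.1.orderEmbOfFin J.2))
    exact Matrix.linearIndependent_rows_iff_isUnit.2
      ((Matrix.isUnit_iff_isUnit_det _).2 (isUnit_iff_ne_zero.2 hQw))
  have hP := presents_rowSpace _ hli
  refine ⟨rowSpace _ hli, fun U hU => hA U hU _ _ hP (hAw U (hfin.mem_toFinset.2 hU)), ?_,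
    definedOver_of_presents hP⟩
  rw [mem_genericLocus_iff hP]
  exact fun s hs => hS s _ (hSw s (Finset.mem_univ s)) hs

theorem dense_genericLocus [Infinite K] : Dense (genericLocus K d n) :=
  (dense_definedOver (k := ⊤) (Infinite.of_injective _
    (Subfield.topEquiv (K := K)).symm.injective)).mono fun _ h => h.1

end Density

/-! ### Vector configurations with the same bases. -/

section Matroid

variable {F F' E : Type*} [Field F] [Field F'] {r : ℕ}

/-- As `x` spans, an independent set extends to a basis, and bases transfer. -/
theorem LinearIndepOn.of_forall_bases {x : E → Fin r → F} {x' : E → Fin r → F'}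
    (hx : Submodule.span F (Set.range x) = ⊤)
    (h : ∀ s : Fin r ↪ E, LinearIndependent F (x ∘ s) → LinearIndependent F' (x' ∘ s))
    {S : Set E} (hS : LinearIndepOn F x S) : LinearIndepOn F' x' S := by
  obtain ⟨b, -, hSb, hspan, hb⟩ := exists_linearIndepOn_extension hS (Set.subset_univ S)
  rw [Set.image_univ] at hspan
  have htop : ⊤ ≤ Submodule.span F (Set.range fun i : b => x i) := by
    rw [← hx, Submodule.span_le, ← Set.image_eq_range]
    exact hspan
  let B : Basis b F (Fin r → F) := Basis.mk hb htop
  have : Finite b := Module.Finite.finite_basis B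
  have : Fintype b := Fintype.ofFinite b
  have hcard : Fintype.card b = r := by
    rw [← finrank_eq_card_basis B]; simp
  let e : Fin r ≃ b := (Fintype.equivFinOfCardEq hcard).symm
  have h1 := h (e.toEmbedding.trans (Function.Embedding.subtype _)) (hb.comp e e.injective)
  have h2 : LinearIndepOn F' x' b := by
    have h3 := h1.comp e.symm e.symm.injective
    have h4 : (x' ∘ (e.toEmbedding.trans (Function.Embedding.subtype _))) ∘ e.symm =
        fun i : b => x' i := by
      funext i
      simp
    rwa [h4] at h3
  exact h2.mono hSb

/-- Spanning families over two fields with the same bases have the same span relations. -/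
theorem mem_span_image_of_forall_bases {x : E → Fin r → F} {x' : E → Fin r → F'}
    (hx : Submodule.span F (Set.range x) = ⊤) (hx' : Submodule.span F' (Set.range x') = ⊤)
    (h : ∀ s : Fin r ↪ E, LinearIndependent F (x ∘ s) ↔ LinearIndependent F' (x' ∘ s))
    {G : Set E} {i : E} (hi : x i ∈ Submodule.span F (x '' G)) :
    x' i ∈ Submodule.span F' (x' '' G) := by
  -- `I` is a basis of `G` for `x'`. It is independent for `x` too, and also maximal in `G` there,
  -- since a larger independent set would transfer back.
  obtain ⟨I, hIG, -, hspan, hI'⟩ :=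
    exists_linearIndepOn_extension (linearIndepOn_empty F' x') (Set.empty_subset G)
  have hI : LinearIndepOn F x I := hI'.of_forall_bases hx' fun s => (h s).2
  have h1 : Submodule.span F (x '' G) ≤ Submodule.span F (x '' I) := by
    rw [Submodule.span_le]
    rintro _ ⟨g, hg, rfl⟩
    exact hI.mem_span_iff.2 fun hins => hI'.mem_span_iff.1 (hspan ⟨g, hg, rfl⟩)
      (hins.of_forall_bases hx fun s => (h s).1)
  refine Submodule.span_mono (Set.image_mono hIG) (hI'.mem_span_iff.2 fun hins => ?_)
  exact hI.mem_span_iff.1 (h1 hi) (hins.of_forall_bases hx' fun s => (h s).2)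

/-- Over an infinite field, some linear form has a prescribed zero set among finitely many
vectors, provided that the vectors outside are not in the span of those inside. -/
theorem exists_dual_eq_zero_iff_mem [Infinite F] [Finite E] {x : E → Fin r → F} {G : Set E}
    (h : ∀ i ∉ G, x i ∉ Submodule.span F (x '' G)) :
    ∃ f : Dual F (Fin r → F), ∀ i, f (x i) = 0 ↔ i ∈ G := by
  -- Over an infinite field the annihilator of the span is not a union of finitely many proper
  -- subspaces.
  obtain ⟨f, hf, hne⟩ := Module.Dual.exists_forall_mem_ne_zero_of_forall_exists
    (Submodule.span F (x '' G)).dualAnnihilator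
    (fun i : {i // i ∉ G} => Dual.eval F (Fin r → F) (x i)) fun i => by
      obtain ⟨f, hfi, hle⟩ := Submodule.exists_le_ker_of_notMem (h i i.2)
      exact ⟨f, (Submodule.mem_dualAnnihilator f).2 fun w hw => hle hw, hfi⟩
  refine ⟨f, fun i => ⟨fun h0 => by_contra fun hi => hne ⟨i, hi⟩ h0, fun hi => ?_⟩⟩
  exact (Submodule.mem_dualAnnihilator f).1 hf _ (Submodule.subset_span ⟨i, hi, rfl⟩)

end Matroid

/-! ### Trivially valued subfields and points with prescribed valuations. -/

section Valuation

variable {K : Type*} [Field K] (v : AddValuation K (WithTop ℝ))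

/-- The valuation is zero on the nonzero elements of the subfield. -/
def TriviallyValued (k : Subfield K) : Prop := ∀ a ∈ k, a ≠ 0 → v a = 0

variable {v}

theorem TriviallyValued.nonneg {k : Subfield K} (hk : TriviallyValued v k) (c : k) :
    0 ≤ v (c : K) := by
  by_cases hc : (c : K) = 0
  · rw [hc, AddValuation.map_zero]; exact le_top
  · exact (hk c c.2 hc).ge

/-- If `v a < 0`, the leading term of a monic equation has valuation strictly below all others and
cannot cancel. -/
theorem TriviallyValued.nonneg_of_isIntegral {k : Subfield K} (hk : TriviallyValued v k) {a : K}
    (ha : IsIntegral k a) : 0 ≤ v a := by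
  obtain ⟨p, hp, hpa⟩ := ha
  by_contra! hlt
  obtain ⟨t, ht⟩ := WithTop.ne_top_iff_exists.1 hlt.ne_top
  have ht0 : t < 0 := by
    rw [← ht] at hlt
    exact_mod_cast hlt
  have hpow : ∀ i : ℕ, v (a ^ i) = ((i * t : ℝ) : WithTop ℝ) := by
    intro i
    rw [AddValuation.map_pow, ← ht, ← WithTop.coe_nsmul, nsmul_eq_mul]
  rw [← Polynomial.aeval_def, Polynomial.aeval_eq_sum_range, Finset.sum_range_succ,
    hp.coeff_natDegree, one_smul] at hpa
  have h1 : v (a ^ p.natDegree) < v (∑ i ∈ Finset.range p.natDegree, p.coeff i • a ^ i) := by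
    apply AddValuation.map_lt_sum v
    · rw [hpow]; exact WithTop.coe_ne_top
    · intro i hi
      have h2 : p.coeff i • a ^ i = (p.coeff i : K) * a ^ i := rfl
      rw [h2, AddValuation.map_mul]
      have h3 : v (a ^ p.natDegree) < v (a ^ i) := by
        rw [hpow, hpow, WithTop.coe_lt_coe]
        have : (i : ℝ) < p.natDegree := by exact_mod_cast Finset.mem_range.1 hi
        nlinarith
      exact h3.trans_le (le_add_of_nonneg_left (hk.nonneg _))
  rw [eq_neg_of_add_eq_zero_left hpa, AddValuation.map_neg] at h1
  exact lt_irrefl _ h1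

theorem TriviallyValued.algebraicClosure {k : Subfield K} (hk : TriviallyValued v k) :
    TriviallyValued v (algebraicClosure k K).toSubfield := by
  intro a ha ha0
  have hint : IsIntegral k a := (mem_algebraicClosure_iff.1 ha).isIntegral
  have h1 := hk.nonneg_of_isIntegral hint
  have h2 := hk.nonneg_of_isIntegral (mem_algebraicClosure_iff.1 (inv_mem ha)).isIntegral
  have h3 : v a + v a⁻¹ = 0 := by
    rw [← AddValuation.map_mul, mul_inv_cancel₀ ha0, AddValuation.map_one]
  exact le_antisymm (h3 ▸ le_add_of_nonneg_right h2) h1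

/-- The given field may be finite, whereas avoiding finitely many subspaces needs an infinite one;
its algebraic closure in `K` is infinite and still trivially valued. -/
theorem HasConstantCoefficients.exists_infinite [IsAlgClosed K] {m n : ℕ} {X : Gr K m n}
    (h : HasConstantCoefficients v X) :
    ∃ k : Subfield K, Infinite k ∧ TriviallyValued v k ∧ DefinedOver k X := by
  obtain ⟨k, hk, E, hE, hX⟩ := h
  refine ⟨(algebraicClosure k K).toSubfield, ?_, TriviallyValued.algebraicClosure hk, E,
    fun a ha i => ?_, hX⟩
  · have := (algebraicClosure.isAlgClosure k K).isAlgClosed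
    exact IsAlgClosed.instInfinite
  · exact (algebraicClosure k K).algebraMap_mem ⟨a i, hE a ha i⟩

variable {E : Type*} {r : ℕ}

/-- A point of a linear space given by `x` over `k` can be replaced by a point with the same
valuations of the linear space given by `x'` over `k'`, if the dependencies of `x'` are
dependencies of `x`. -/
theorem exists_dotProduct_val_eq [Finite E] {k k' : Subfield K} [Infinite k']
    (hk : TriviallyValued v k) (hk' : TriviallyValued v k') {x : E → Fin r → k}
    {x' : E → Fin r → k'}
    (H : ∀ (G : Set E) i, x' i ∈ Submodule.span k' (x' '' G) → x i ∈ Submodule.span k (x '' G))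
    {a : Fin r → K} (ha : ∀ i, a ⬝ᵥ (k.subtype ∘ x i) ≠ 0) :
    ∃ a' : Fin r → K, ∀ i, v (a' ⬝ᵥ (k'.subtype ∘ x' i)) = v (a ⬝ᵥ (k.subtype ∘ x i)) := by
  classical
  have := Fintype.ofFinite E
  rcases isEmpty_or_nonempty E with _ | _
  · exact ⟨0, isEmptyElim⟩
  set y : E → K := fun i => a ⬝ᵥ (k.subtype ∘ x i) with hy
  -- Superlevel sets of the valuation are flats: by the ultrametric inequality and the triviality of
  -- `v` on `k`, the bound passes to `k`-linear combinations, and `H` carries span relations over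
  -- from `x'`.
  have hsep : ∀ j, ∀ i ∉ {g | v (y j) < v (y g)},
      x' i ∉ Submodule.span k' (x' '' {g | v (y j) < v (y g)}) := by
    intro j i hi hmem
    refine hi ?_
    have hz : ∀ z ∈ Submodule.span k (x '' {g | v (y j) < v (y g)}),
        v (y j) < v (a ⬝ᵥ (k.subtype ∘ z)) := by
      intro z hz
      induction hz using Submodule.span_induction with
      | mem z hz =>
        obtain ⟨g, hg, rfl⟩ := hz
        exact hg
      | zero =>
        have : a ⬝ᵥ (k.subtype ∘ (0 : Fin r → k)) = 0 := by simp [dotProduct]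
        rw [this, AddValuation.map_zero, lt_top_iff_ne_top, AddValuation.ne_top_iff]
        exact ha j
      | add z w _ _ h1 h2 =>
        have : a ⬝ᵥ (k.subtype ∘ (z + w)) =
            a ⬝ᵥ (k.subtype ∘ z) + a ⬝ᵥ (k.subtype ∘ w) := by
          simp [dotProduct, mul_add, Finset.sum_add_distrib]
        rw [this]
        exact AddValuation.map_lt_add v h1 h2
      | smul c z _ h1 =>
        have : a ⬝ᵥ (k.subtype ∘ (c • z)) = (c : K) * (a ⬝ᵥ (k.subtype ∘ z)) := by
          simp [dotProduct, Finset.mul_sum, mul_left_comm]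
        rw [this, AddValuation.map_mul]
        exact h1.trans_le (le_add_of_nonneg_left (hk.nonneg c))
    exact hz _ (H _ _ hmem)
  choose f hf using fun j => exists_dual_eq_zero_iff_mem (hsep j)
  let L : Finset (WithTop ℝ) := Finset.univ.image fun i => v (y i)
  have hL : ∀ γ ∈ L, ∃ j, v (y j) = γ := fun γ hγ => by simpa [L] using hγ
  choose! ρ hρ using hL
  -- For each value `γ` of `v ∘ y`, the form `f (ρ γ)`, which vanishes exactly where `v (y g) > γ`,
  -- is scaled by an element of valuation `γ`. At `i`, the terms with `γ < v (y i)` vanish, the one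
  -- with `γ = v (y i)` has exactly that valuation, and the rest have larger valuation.
  refine ⟨fun q => ∑ γ ∈ L, y (ρ γ) * (f (ρ γ) (Pi.single q 1) : k'), fun i => ?_⟩
  have hexp : (fun q => ∑ γ ∈ L, y (ρ γ) * ((f (ρ γ) (Pi.single q 1) : k') : K)) ⬝ᵥ
      (k'.subtype ∘ x' i) = ∑ γ ∈ L, y (ρ γ) * ((f (ρ γ) (x' i) : k') : K) := by
    simp only [dotProduct, Finset.sum_mul]
    rw [Finset.sum_comm]
    refine Finset.sum_congr rfl fun γ _ => ?_
    rw [dual_apply_eq_dotProduct]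
    simp [dotProduct, Finset.mul_sum, mul_assoc]
  have hiL : v (y i) ∈ L := Finset.mem_image_of_mem _ (Finset.mem_univ i)
  rw [hexp, ← Finset.add_sum_erase L _ hiL]
  have hmain : v (y (ρ (v (y i))) * ((f (ρ (v (y i))) (x' i) : k') : K)) = v (y i) := by
    rw [AddValuation.map_mul, hρ _ hiL, hk' _ (SetLike.coe_mem _), add_zero]
    rw [ne_eq, ZeroMemClass.coe_eq_zero, hf, Set.mem_ofPred_eq, hρ _ hiL]
    exact lt_irrefl _
  rw [AddValuation.map_add_eq_of_lt_left, hmain]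
  rw [hmain]
  apply AddValuation.map_lt_sum v
  · exact (AddValuation.ne_top_iff v).2 (ha i)
  · intro γ hγ
    obtain ⟨hne, hγL⟩ := Finset.mem_erase.1 hγ
    rcases lt_or_gt_of_ne hne with hlt | hgt
    · have : f (ρ γ) (x' i) = 0 := (hf _ _).2 (by rwa [Set.mem_ofPred_eq, hρ _ hγL])
      rw [this, ZeroMemClass.coe_zero, mul_zero, AddValuation.map_zero, lt_top_iff_ne_top,
        AddValuation.ne_top_iff]
      exact ha i
    · rw [AddValuation.map_mul, hρ _ hγL]
      exact hgt.trans_le (le_add_of_nonneg_right (hk'.nonneg _))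

end Valuation

/-! ### Independence of the tropicalization from `X`. -/

section Tropicalization

variable {K : Type*} [Field K] {d n : ℕ}

theorem linearIndependent_row_of_map {F : Type*} [Field F] {m : ℕ} (f : F →+* K)
    {W : Matrix (Fin m) (Fin n) F} (h : LinearIndependent K (W.map f).row) :
    LinearIndependent F W.row := by
  rw [← Matrix.vecMul_injective_iff] at h ⊢
  intro a b hab
  have h1 : (f ∘ a) = f ∘ b := by
    apply h
    funext c
    have h2 := congrArg f (congrFun hab c)
    rwa [RingHom.map_vecMul, RingHom.map_vecMul] at h2
  funext i
  exact f.injective (congrFun h1 i)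

theorem cofactorVec_map {F : Type*} [Field F] (f : F →+* K) (W : Matrix (Fin (d + 1)) (Fin n) F)
    (J : KSubset d n) : cofactorVec (W.map f) J = f ∘ cofactorVec W J := by
  funext i
  simp only [cofactorVec, Function.comp_apply, map_mul, map_pow, map_neg, map_one, maxMinor,
    RingHom.map_det]
  rfl

/-- The right-hand side does not mention `X`: the matroid of `L(X)` is constant on the generic
locus. -/
theorem linearIndependent_cofactorVec_iff {F : Type*} [Field F] (f : F →+* K)
    {W : Matrix (Fin (d + 1)) (Fin n) F} {X : Gr K (d + 1) n} (hX : X ∈ genericLocus K d n)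
    (h : Presents (W.map f) X) (s : Fin (d + 1) ↪ KSubset d n) :
    LinearIndependent F (cofactorVec W ∘ s) ↔ ¬ MinorIdenticallyZero K s := by
  have h1 : f (coordMinor W s) = coordMinor (W.map f) s := map_coordMinorOver f W s
  rw [← not_iff_not, ← coordMinor_eq_zero_iff_not_linearIndependent, not_not,
    ← map_eq_zero f, h1]
  exact ⟨fun h0 => by_contra fun hs => hX s hs _ h h0, fun hs => hs X _ h⟩

theorem trop_spaceL_subset {v : AddValuation K (WithTop ℝ)} {X X' : Gr K (d + 1) n}
    (hX : X ∈ genericLocus K d n) (hX' : X' ∈ genericLocus K d n) {k k' : Subfield K}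
    [Infinite k'] (hk : TriviallyValued v k) (hk' : TriviallyValued v k')
    (hkX : DefinedOver k X) (hkX' : DefinedOver k' X') :
    trop v (spaceL X) ⊆ trop v (spaceL X') := by
  obtain ⟨W, hW⟩ := hkX.exists_presents
  obtain ⟨W', hW'⟩ := hkX'.exists_presents
  -- The valuation vectors are matched exactly, so the inclusion already holds before taking
  -- closures.
  apply closure_mono
  rintro _ ⟨x, hx, hmem, hne, rfl⟩
  obtain ⟨a, rfl⟩ := (mk_mem_spaceL_iff hW hx).1 hmem
  obtain ⟨a', ha'⟩ := exists_dotProduct_val_eq (a := a) hk hk'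
    (x := cofactorVec W) (x' := cofactorVec W')
    (fun G i => mem_span_image_of_forall_bases
      (span_cofactorVec (linearIndependent_row_of_map _ hW'.linearIndependent))
      (span_cofactorVec (linearIndependent_row_of_map _ hW.linearIndependent))
      fun s => (linearIndependent_cofactorVec_iff _ hX' hW' s).trans
        (linearIndependent_cofactorVec_iff _ hX hW s).symm)
    (fun J => by
      rw [← cofactorVec_map, ← augMinor_eq_dotProduct]
      exact hne J)
  replace ha' : ∀ J, v (augMinor (W'.map k'.subtype) a' J) =
      v (augMinor (W.map k.subtype) a J) := fun J => by
    rw [augMinor_eq_dotProduct, augMinor_eq_dotProduct, cofactorVec_map, cofactorVec_map]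
    exact ha' J
  have hne' : ∀ J, augMinor (W'.map k'.subtype) a' J ≠ 0 := fun J => by
    rw [← AddValuation.ne_top_iff v, ha', AddValuation.ne_top_iff]
    exact hne J
  obtain ⟨J, -⟩ := Function.ne_iff.1 hx
  have hx' : augMinor (W'.map k'.subtype) a' ≠ 0 := fun h0 => hne' J (congrFun h0 J)
  refine ⟨_, hx', (mk_mem_spaceL_iff hW' hx').2 ⟨a', rfl⟩, hne', ?_⟩
  congr 1
  funext J
  rw [negVal, negVal, ha']

end Tropicalization

theorem proposition6p1 {K : Type*} [Field K] [IsAlgClosed K] (v : AddValuation K (WithTop ℝ))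
    (d n : ℕ) (hdn : d + 1 ≤ n) :
    IsOpen (genericLocus K d n) ∧ Dense (genericLocus K d n) ∧
      (∀ k : Subfield K, Infinite k → Dense {X ∈ genericLocus K d n | DefinedOver k X}) ∧
      ∃ T : Set (TropTorus (KSubset d n)), ∀ X ∈ genericLocus K d n,
        HasConstantCoefficients v X → trop v (spaceL X) = T := by
  refine ⟨isOpen_genericLocus K d n, dense_genericLocus, fun k hk => dense_definedOver hk, ?_⟩
  by_cases h : ∃ X₀ ∈ genericLocus K d n, HasConstantCoefficients v X₀
  · obtain ⟨X₀, hX₀, hc₀⟩ := h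
    obtain ⟨k₀, _, hk₀, hd₀⟩ := hc₀.exists_infinite
    refine ⟨trop v (spaceL X₀), fun X hX hc => ?_⟩
    obtain ⟨k, _, hk, hd⟩ := hc.exists_infinite
    exact (trop_spaceL_subset hX hX₀ hk hk₀ hd hd₀).antisymm
      (trop_spaceL_subset hX₀ hX hk₀ hk hd₀ hd)
  -- This case does occur: if `v` is nontrivial on the prime field, no subfield is trivially valued.
  · exact ⟨∅, fun X hX hc => (h ⟨X, hX, hc⟩).elim⟩
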